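/- **Setting.** A transducer $\mathscr A=(Q,A,\cdot,\circ)$ consists of a finite non-empty set $Q$ of states, a finite alphabet $A$ and maps $Q\times A\to Q$, $(q,a)\mapsto q\cdot a$, and $Q\times A\to A$, $(q,a)\mapsto q\circ a$; its edges are $q\xrightarrow{a|q\circ a}q\cdot a$. It is *bireversible* if both its input automaton (edges $q\xrightarrow{a}q\cdot a$) and its output automaton (edges $q\xrightarrow{q\circ a}q\cdot a$) are deterministic and complete and every letter acts in them as a permutation of $Q$. Then every map $a\mapsto q\circ a$ is a permutation of $A$, each state $q$ acts on $A^*$ by $q\circ(a_1\cdots a_n)=(q\circ a_1)\,\big((q\cdot a_1)\circ(a_2\cdots a_n)\big)$ as an automorphism of the rooted tree $A^*$, and these automorphisms generate a group $\mathcal G(\mathscr A)=F_Q/N$, where $F_Q$ is the free group on $Q$. Let $\widetilde Q=Q\sqcup Q^{-1}$ and let $\overline w$ be the reduced form of $w\in\widetilde Q^*$. Let $\widetilde{\mathscr A}=\mathscr A\sqcup\mathscr A^{-1}$, with state set $\widetilde Q$, where $\mathscr A^{-1}$ has an edge $q^{-1}\xrightarrow{b|a}p^{-1}$ for each edge $q\xrightarrow{a|b}p$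 of $\mathscr A$. Its $n$-th power $\widetilde{\mathscr A}^{\,n}$ has state set $\widetilde Q^n$; in the state $q_1\cdots q_n$ the state $q_1$ reads the input letter and each $q_{i+1}$ reads the output of $q_i$. For $n\ge 1$ put $$\chi(n)=\min\{\|(\widetilde{\mathscr A}^{\,n},w)\| : w\in\widetilde Q^n,\ \overline w=w\},$$ where $\|(\Gamma,w)\|$ is the number of vertices of the connected component of $w$ in $\Gamma$. The enriched dual $\partial\mathscr A^-$ has state set $A$, alphabet $\widetilde Q$ and, for each edge $p\xrightarrow{a|b}q$ of $\mathscr A$, the edges $a\xrightarrow{p|q}b$ and $b\xrightarrow{p^{-1}|q^{-1}}a$. It is invertible, so $\mathcal G(\partial\mathscr A^-)$ acts on the set $\widetilde Q^\omega$ of infinite words. For $\underline v\in\widetilde Q^\omega$, $\mathrm{Sch}(\underline v)$ is the Schreier graph of the stabilizer of $\underline v$, that is, the connected component of $\underline v$ in the orbital graph of this action with respect to the generators $A\cup A^{-1}$; $\|\mathrm{Sch}(\underline v)\|$ is its number of vertices. A point $\underline u=u_1u_2\cdots\in\widetilde Q^\omega$ is *essentially non-trivial* if the sequence $(\overline{u_1\cdots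 u_n})_n$ has a subsequence that converges to an infinite reduced word $\xi$, i.e. $d\to 0$ for the distance $d(w,\xi)=2^{-|w\wedge\xi|}$, where $w\wedge\xi$ is the longest common prefix. **Theorem.** Let $\mathscr A=(Q,A,\cdot,\circ)$ be a bireversible transducer, $Q\neq\emptyset$. For $m\ge 1$ put $B(m)=\big(2^m|A|\,|Q|^m\big)^{|A|}$ and consider the conditions - (ii)$_m$ there are $x,y\in\widetilde Q^*$ with $y$ non-empty, $\overline{xy}=xy$, $|x|+|y|\le m+B(m)$ and $\|\mathrm{Sch}(xy^\omega)\|=\chi(m)$; - (iii)$_m$ $\chi(m)=\chi(m+i)$ for all $0\le i\le B(m)$; - (iv)$_m$ $\chi(m)=\chi(m+i)$ for all $i\ge 0$. Then for every $m\ge1$ the conditions (ii)$_m$, (iii)$_m$, (iv)$_m$ are equivalent to each other. Moreover, the following six conditions are equivalent: - (i) $\mathrm{Sch}(\underline v)$ is finite for some essentially non-trivial $\underline v\in\widetilde Q^\omega$; - (ii) (ii)$_m$ holds for some $m\ge1$; - (iii) (iii)$_m$ holds for some $m\ge1$; - (iv) (iv)$_m$ holds for some $m\ge1$; - (v) there is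 a non-empty reduced word $y\in\widetilde Q^*$ such that $\mathrm{Sch}(y^\omega)$ is finite; - (vi) $\mathcal G(\mathscr A)=F_Q/N$ is not free on $Q$ (that is, $F_Q\to\mathcal G(\mathscr A)$ is not injective), with a non-trivial relation $y^r$: there are $y\in\widetilde Q^*$ with $\overline y\ne1$ and an integer $r\ge1$ such that $y^r=1$ in $\mathcal G(\mathscr A)$. -/

import Mathlib

open Filter Topology

/-- A directed graph with vertex set `V` and edges labelled by `L`;
`Γ.Edge v l w` says that there is an edge from `v` to `w` labelled `l`. -/
structure LabelledDigraph (V L : Type*) where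
  Edge : V → L → V → Prop

namespace LabelledDigraph

variable {V L : Type*}

/-- The vertex set of the connected component of `v`. -/
def component (Γ : LabelledDigraph V L) (v : V) : Set V :=
  {w | Relation.EqvGen (fun x y => ∃ l, Γ.Edge x l y) v w}

/-- `‖(Γ, v)‖`: the number of vertices of the connected component of `v`. -/
noncomputable def size (Γ : LabelledDigraph V L) (v : V) : ℕ∞ := (Γ.component v).encard

/-- Deterministic and complete, and every letter acts on the vertices as a permutation. -/
def IsReversible (Γ : LabelledDigraph V L) : Prop :=
  (∀ v l, ∃! w, Γ.Edge v l w) ∧ (∀ w l, ∃! v, Γ.Edge v l w)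

end LabelledDigraph

/-- The orbital graph `Γ(H, S, X)` of a group `H` acting on `X`, with respect to a family
`s : S → H` of generators and their formal inverses: there is an edge from `x` to `s(a)^{±1} x`
labelled `a^{±1}`. The letters `a` and `a⁻¹` are `(a, true)` and `(a, false)`. -/
def orbitalGraph {S H : Type*} (X : Type*) [Group H] [MulAction H X] (s : S → H) :
    LabelledDigraph X (S × Bool) where
  Edge x l y := (if l.2 then s l.1 else (s l.1)⁻¹) • x = y

/-- A Mealy machine with states `Q` and (input and output) alphabet `A`:
`next q a` is `q · a` and `out q a` is `q ∘ a`. -/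
structure Transducer (Q A : Type*) where
  next : Q → A → Q
  out : Q → A → A

namespace Transducer

variable {Q A : Type*}

/-- The input automaton, with an edge `q → q · a` labelled `a`. -/
def inputAutomaton (T : Transducer Q A) : LabelledDigraph Q A where
  Edge q a p := T.next q a = p

/-- The output automaton, with an edge `q → q · a` labelled `q ∘ a`. -/
def outputAutomaton (T : Transducer Q A) : LabelledDigraph Q A where
  Edge q b p := ∃ a, T.out q a = b ∧ T.next q a = p

/-- The machine as a digraph, with edges `q → q · a` labelled `a | q ∘ a`. -/
def digraph (T : Transducer Q A) : LabelledDigraph Q (A × A) where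
  Edge q l p := T.next q l.1 = p ∧ T.out q l.1 = l.2

def IsInvertible (T : Transducer Q A) : Prop := ∀ q, Function.Bijective (T.out q)

def IsReversible (T : Transducer Q A) : Prop := T.inputAutomaton.IsReversible

def IsBireversible (T : Transducer Q A) : Prop :=
  T.inputAutomaton.IsReversible ∧ T.outputAutomaton.IsReversible

theorem IsReversible.bijective {T : Transducer Q A} (h : T.IsReversible) (a : A) :
    Function.Bijective (fun q => T.next q a) := by
  refine ⟨fun p q hpq => ?_, fun p => ?_⟩
  · obtain ⟨r, -, hr⟩ := h.2 (T.next q a) a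
    rw [hr p hpq, hr q rfl]
  · obtain ⟨r, hr, -⟩ := h.2 p a
    exact ⟨r, hr⟩

theorem IsBireversible.isInvertible [Finite A] {T : Transducer Q A} (h : T.IsBireversible) :
    T.IsInvertible := by
  intro q
  rw [← Finite.surjective_iff_bijective]
  intro b
  obtain ⟨p, ⟨a, ha, -⟩, -⟩ := h.2.1 q b
  exact ⟨a, ha⟩

/-- The permutation `a ↦ q ∘ a` of the alphabet. -/
noncomputable def outEquiv (T : Transducer Q A) (h : T.IsInvertible) (q : Q) : A ≃ A :=
  Equiv.ofBijective (T.out q) (h q)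

/-- The permutation `q ↦ q · a` of the states. -/
noncomputable def nextEquiv (T : Transducer Q A) (h : T.IsReversible) (a : A) : Q ≃ Q :=
  Equiv.ofBijective (fun q => T.next q a) (h.bijective a)

/-- The inverse machine: the formal inverse of the state `q` is again written `q`, and there is an
edge `q → p` labelled `b | a` whenever the original machine has the edge `q → p` labelled
`a | b`. -/
noncomputable def inverse (T : Transducer Q A) (h : T.IsInvertible) : Transducer Q A where
  next q b := T.next q ((T.outEquiv h q).symm b)
  out q b := (T.outEquiv h q).symm b

/-- The disjoint union of a machine and its inverse. The states `q` and `q⁻¹` are `(q, true)` and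
`(q, false)`. -/
noncomputable def withInverse (T : Transducer Q A) (h : T.IsInvertible) :
    Transducer (Q × Bool) A where
  next q a := (if q.2 then T.next q.1 a else (T.inverse h).next q.1 a, q.2)
  out q a := if q.2 then T.out q.1 a else (T.inverse h).out q.1 a

/-- The dual machine: `a → b` labelled `p | q` is an edge of it if and only if `p → q` labelled
`a | b` is an edge of `T`. -/
def dual (T : Transducer Q A) : Transducer A Q where
  next a q := T.out q a
  out a q := T.next q a

/-- The inverse transducer on the involutive alphabet obtained by adding, for each edge `q → p`
labelled `a | b`, the edge `p → q` labelled `a⁻¹ | b⁻¹`. The letters `a` and `a⁻¹` are `(a, true)`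
and `(a, false)`. -/
noncomputable def enrich (T : Transducer Q A) (h : T.IsReversible) :
    Transducer Q (A × Bool) where
  next q l := if l.2 then T.next q l.1 else (T.nextEquiv h l.1).symm q
  out q l := (if l.2 then T.out q l.1 else T.out ((T.nextEquiv h l.1).symm q) l.1, l.2)

theorem IsInvertible.dual_isReversible {T : Transducer Q A} (h : T.IsInvertible) :
    T.dual.IsReversible := by
  refine ⟨fun a q => ⟨T.out q a, rfl, fun _ hb => hb.symm⟩, fun b q => ?_⟩
  obtain ⟨a, ha⟩ := (h q).2 b
  exact ⟨a, ha, fun c hc => (h q).1 (hc.trans ha.symm)⟩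

/-- The enriched dual machine `(∂T)⁻`, with states `A` and alphabet `Q ∪ Q⁻¹`. -/
noncomputable def enrichedDual [Finite A] (T : Transducer Q A) (h : T.IsBireversible) :
    Transducer A (Q × Bool) :=
  T.dual.enrich h.isInvertible.dual_isReversible

theorem enrichedDual_isInvertible [Finite A] (T : Transducer Q A) (h : T.IsBireversible) :
    (T.enrichedDual h).IsInvertible := by
  have key (b : A) (q : Q) : T.out q ((T.dual.nextEquiv
      h.isInvertible.dual_isReversible q).symm b) = b :=
    (T.dual.nextEquiv h.isInvertible.dual_isReversible q).apply_symm_apply b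
  intro b
  constructor
  · rintro ⟨q, ε⟩ ⟨p, δ⟩ hqp
    have hεδ : ε = δ := congrArg Prod.snd hqp
    subst hεδ
    have h1 := congrArg Prod.fst hqp
    cases ε
    · obtain ⟨r, -, hr⟩ := h.2.2 (T.next p ((T.dual.nextEquiv
        h.isInvertible.dual_isReversible p).symm b)) b
      rw [hr q ⟨_, key b q, h1⟩, hr p ⟨_, key b p, rfl⟩]
    · obtain ⟨r, -, hr⟩ := h.1.2 (T.next p b) b
      rw [hr q h1, hr p rfl]
  · rintro ⟨p, ε⟩
    cases ε
    · obtain ⟨q, ⟨a, ha, hq⟩, -⟩ := h.2.2 p b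
      have hqa : (T.dual.nextEquiv h.isInvertible.dual_isReversible q).symm b = a :=
        (h.isInvertible q).1 ((key b q).trans ha.symm)
      exact ⟨(q, false), Prod.ext ((congrArg (T.next q) hqa).trans hq) rfl⟩
    · obtain ⟨q, hq, -⟩ := h.1.2 p b
      exact ⟨(q, true), Prod.ext hq rfl⟩

/-- The action of a state on finite words,
`q ∘ (a₁ a₂ … aₙ) = (q ∘ a₁) ((q · a₁) ∘ (a₂ … aₙ))`. -/
def act (T : Transducer Q A) : Q → List A → List A
  | _, [] => []
  | q, a :: u => T.out q a :: T.act (T.next q a) u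

/-- The state reached from `q` after reading the first `n` letters of an infinite word. -/
def run (T : Transducer Q A) (q : Q) (u : Stream' A) : ℕ → Q
  | 0 => q
  | n + 1 => T.next (T.run q u n) (u.get n)

/-- The extension of the action of a state to infinite words. -/
def boundaryAct (T : Transducer Q A) (q : Q) (u : Stream' A) : Stream' A :=
  fun n => T.out (T.run q u n) (u.get n)

theorem inverse_act_act (T : Transducer Q A) (h : T.IsInvertible) (q : Q) (u : List A) :
    (T.inverse h).act q (T.act q u) = u := by
  induction u generalizing q with
  | nil => rfl
  | cons a u ih =>
    have : (T.outEquiv h q).symm (T.out q a) = a := (T.outEquiv h q).symm_apply_apply a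
    simp only [act, inverse, this]
    exact congrArg _ (ih _)

theorem act_inverse_act (T : Transducer Q A) (h : T.IsInvertible) (q : Q) (u : List A) :
    T.act q ((T.inverse h).act q u) = u := by
  induction u generalizing q with
  | nil => rfl
  | cons a u ih =>
    have : T.out q ((T.outEquiv h q).symm a) = a := (T.outEquiv h q).apply_symm_apply a
    simp only [act, inverse, this]
    exact congrArg _ (ih _)

theorem inverse_boundaryAct_boundaryAct (T : Transducer Q A) (h : T.IsInvertible) (q : Q)
    (u : Stream' A) : (T.inverse h).boundaryAct q (T.boundaryAct q u) = u := by
  have key (p : Q) (a : A) : (T.outEquiv h p).symm (T.out p a) = a :=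
    (T.outEquiv h p).symm_apply_apply a
  have hrun (n : ℕ) : (T.inverse h).run q (T.boundaryAct q u) n = T.run q u n := by
    induction n with
    | zero => rfl
    | succ n ih =>
      change T.next _ ((T.outEquiv h _).symm _) = _
      rw [ih]
      exact congrArg _ (key _ _)
  funext n
  change (T.outEquiv h _).symm _ = _
  rw [hrun]
  exact key _ _

theorem boundaryAct_inverse_boundaryAct (T : Transducer Q A) (h : T.IsInvertible) (q : Q)
    (u : Stream' A) : T.boundaryAct q ((T.inverse h).boundaryAct q u) = u := by
  have key (p : Q) (a : A) : T.out p ((T.outEquiv h p).symm a) = a :=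
    (T.outEquiv h p).apply_symm_apply a
  have hrun (n : ℕ) : T.run q ((T.inverse h).boundaryAct q u) n = (T.inverse h).run q u n := by
    induction n with
    | zero => rfl
    | succ n ih =>
      change T.next _ _ = T.next _ _
      rw [ih]
      rfl
  funext n
  change T.out _ _ = _
  rw [hrun]
  exact key _ _

/-- The automorphism of the rooted tree of finite words defined by a state. -/
noncomputable def treeAut (T : Transducer Q A) (h : T.IsInvertible) (q : Q) :
    Equiv.Perm (List A) where
  toFun := T.act q
  invFun := (T.inverse h).act q
  left_inv := T.inverse_act_act h q
  right_inv := T.act_inverse_act h q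

/-- The permutation of the boundary (the set of infinite words) defined by a state. -/
noncomputable def boundaryAut (T : Transducer Q A) (h : T.IsInvertible) (q : Q) :
    Equiv.Perm (Stream' A) where
  toFun := T.boundaryAct q
  invFun := (T.inverse h).boundaryAct q
  left_inv := T.inverse_boundaryAct_boundaryAct h q
  right_inv := T.boundaryAct_inverse_boundaryAct h q

/-- The group `𝒢(T)` generated by the tree automorphisms of the states. -/
def automatonGroup (T : Transducer Q A) (h : T.IsInvertible) : Subgroup (Equiv.Perm (List A)) :=
  Subgroup.closure (Set.range (T.treeAut h))

/-- The canonical epimorphism from the free group on the states onto `𝒢(T)`;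
its kernel is the group `N` of relations, `𝒢(T) = F_Q / N`. -/
noncomputable def presentation (T : Transducer Q A) (h : T.IsInvertible) :
    FreeGroup Q →* T.automatonGroup h :=
  FreeGroup.lift fun q => ⟨T.treeAut h q, Subgroup.subset_closure ⟨q, rfl⟩⟩

/-- The word of states `q₁ … qₙ` reading a letter: `q₁` reads it, and each further state reads the
output of the preceding one. -/
def nextWord (T : Transducer Q A) : List Q → A → List Q
  | [], _ => []
  | q :: w, a => T.next q a :: T.nextWord w (T.out q a)

/-- The letter finally output by the word of states `q₁ … qₙ`. -/
def outWord (T : Transducer Q A) : List Q → A → A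
  | [], a => a
  | q :: w, a => T.outWord w (T.out q a)

theorem length_nextWord (T : Transducer Q A) (w : List Q) (a : A) :
    (T.nextWord w a).length = w.length := by
  induction w generalizing a with
  | nil => rfl
  | cons q w ih => simp [nextWord, ih]

/-- The `n`-th power `Tⁿ` (for the product in which the second machine reads the output of the
first); its states are the words of length `n` over `Q`. -/
def pow (T : Transducer Q A) (n : ℕ) : Transducer (List.Vector Q n) A where
  next w a := ⟨T.nextWord w.1 a, (T.length_nextWord w.1 a).trans w.2⟩
  out w a := T.outWord w.1 a

/-- The growth function `χ(n)`: the least number of vertices of the connected component of a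
reduced word of length `n` in the `n`-th power of the union of `T` and its inverse. -/
noncomputable def chi (T : Transducer Q A) (h : T.IsInvertible) (n : ℕ) : ℕ∞ :=
  ⨅ w : {w : List.Vector (Q × Bool) n // FreeGroup.IsReduced w.1},
    ((T.withInverse h).pow n).digraph.size w.1

/-- The Schreier graph `Sch(v)` of the group generated by the enriched dual, at a point `v` of the
boundary, is the connected component of `v` in this graph. -/
noncomputable def schreierGraph [Finite A] (T : Transducer Q A) (h : T.IsBireversible) :
    LabelledDigraph (Stream' (Q × Bool)) (A × Bool) :=
  orbitalGraph (Stream' (Q × Bool)) ((T.enrichedDual h).boundaryAut (T.enrichedDual_isInvertible h))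

/-- `‖Sch(v)‖`, the number of vertices of `Sch(v)`. -/
noncomputable def schreierSize [Finite A] (T : Transducer Q A) (h : T.IsBireversible)
    (v : Stream' (Q × Bool)) : ℕ∞ :=
  (T.schreierGraph h).size v

end Transducer

/-- An infinite word is reduced if all its finite initial segments are. These words are the points
of the boundary of the free group. -/
def IsReducedStream {Q : Type*} (ξ : Stream' (Q × Bool)) : Prop :=
  ∀ n, FreeGroup.IsReduced (ξ.take n)

/-- The length of the longest common initial segment of a finite word and an infinite word. -/
def commonLength {X : Type*} [DecidableEq X] (w : List X) (ξ : Stream' X) : ℕ :=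
  Nat.findGreatest (fun k => ξ.take k <+: w) w.length

/-- The distance `2 ^ (-|w ∧ ξ|)`, in the completion of the free group, between a reduced word `w`
and a boundary point `ξ`. -/
noncomputable def boundaryDist {X : Type*} [DecidableEq X] (w : List X) (ξ : Stream' X) : ℝ :=
  2 ^ (-(commonLength w ξ : ℤ))

/-- An infinite word `u` over `Q ∪ Q⁻¹` is essentially non-trivial if the sequence of the reduced
forms of its finite initial segments has a subsequence that converges to a boundary point of the
free group. -/
def IsEssentiallyNontrivial {Q : Type*} [DecidableEq Q] (u : Stream' (Q × Bool)) : Prop :=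
  ∃ φ : ℕ → ℕ, StrictMono φ ∧ ∃ ξ : Stream' (Q × Bool), IsReducedStream ξ ∧
    Tendsto (fun j => boundaryDist (FreeGroup.reduce (u.take (φ j))) ξ) atTop (𝓝 0)

/-! The letters of `A` act on words over `Q ∪ Q⁻¹`, and both `‖·‖` and `‖Sch(·)‖` count points of
orbits. Passing to a factor of a word never enlarges the orbit: prefixes are equivariant, and
suffixes are so up to a change of the acting letter. Bireversibility makes the action commute with
free reduction. Hence `χ` is monotone and `χ(|reduced prefix of v|) ≤ ‖Sch(v)‖`; a finite `Sch(v)`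
whose prefixes have unbounded reduced length makes `χ` stationary.

Conversely, let `χ(m) = χ(m + B)` and let `u` be a reduced word of length `m + B` realizing `χ(m +
B)`. The windows of `u` of lengths `m` and `m + 1` have exactly `χ(m)` translates, so a translate of
an `m`-window determines its extension by one letter (`encard_streamOrbit_le_of_windows`). Two
`m`-windows of `u` coincide by pigeonhole; repeating the factor between them gives `xy^ω`, all of
whose `(m + 1)`-windows occur in `u`. A translate of `xy^ω` is then determined by its first `m`
letters, so `‖Sch(xy^ω)‖ = χ(m)` (`exists_periodic_of_chi_eq`).

For torsion, a trivially acting block stays trivial under every letter, which leaves finitely many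
translates of its periodic word. Conversely, a finite orbit of a periodic word has a common period,
and a suitable multiple of it is the length of a block that fixes every finite word. -/

/-- The orbit of `x` under a family of self-maps and their (possibly partial) inverses. -/
def familyOrbit {I X : Type*} (f : I → X → X) (x : X) : Set X :=
  {y | Relation.EqvGen (fun x y => ∃ i, f i x = y) x y}

/-! ### Orbits under injective maps, and their projections -/

section FamilyOrbit

variable {I J X Y : Type*} {f : I → X → X} {g : J → Y → Y}

theorem mem_familyOrbit_self (f : I → X → X) (x : X) : x ∈ familyOrbit f x :=
  Relation.EqvGen.refl x

theorem apply_mem_familyOrbit {x y : X} (i : I) (h : y ∈ familyOrbit f x) :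
    f i y ∈ familyOrbit f x :=
  Relation.EqvGen.trans _ _ _ h (Relation.EqvGen.rel _ _ ⟨i, rfl⟩)

theorem one_le_encard_familyOrbit (f : I → X → X) (x : X) : 1 ≤ (familyOrbit f x).encard :=
  Set.one_le_encard_iff_nonempty.2 ⟨x, mem_familyOrbit_self f x⟩

/-- An injective self-map of a finite set is onto, so a finite set stable under the maps is also
stable under their inverses. -/
theorem familyOrbit_subset (hf : ∀ i, Function.Injective (f i)) {S : Set X} (hS : S.Finite)
    (hfS : ∀ i, ∀ x ∈ S, f i x ∈ S) {x : X} (hx : x ∈ S) : familyOrbit f x ⊆ S := by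
  have key : ∀ y z, Relation.EqvGen (fun x y => ∃ i, f i x = y) y z → (y ∈ S ↔ z ∈ S) := by
    intro y z h
    induction h with
    | rel y z h =>
      obtain ⟨i, rfl⟩ := h
      refine ⟨hfS i y, fun hz => ?_⟩
      have himg : f i '' S = S := (hS.image _).eq_of_subset_of_encard_le (Set.image_subset_iff.2 (hfS i))
        (hf i).injOn.encard_image.ge
      obtain ⟨w, hw, hwy⟩ : f i y ∈ f i '' S := himg.symm ▸ hz
      rwa [← hf i hwy]
    | refl => rfl
    | symm _ _ _ ih => exact ih.symm
    | trans _ _ _ _ _ ih₁ ih₂ => exact ih₁.trans ih₂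
  exact fun y hy => (key x y hy).1 hx

theorem mapsTo_familyOrbit {π : X → Y} (h : ∀ x i, ∃ j, π (f i x) = g j (π x)) (x : X) :
    Set.MapsTo π (familyOrbit f x) (familyOrbit g (π x)) := by
  intro y hy
  change Relation.EqvGen _ _ _ at hy
  change Relation.EqvGen _ _ _
  induction hy with
  | rel y z h' =>
    obtain ⟨i, rfl⟩ := h'
    obtain ⟨j, hj⟩ := h y i
    exact Relation.EqvGen.rel _ _ ⟨j, hj.symm⟩
  | refl => exact Relation.EqvGen.refl _
  | symm _ _ _ ih => exact ih.symm
  | trans _ _ _ _ _ ih₁ ih₂ => exact ih₁.trans _ _ _ ih₂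

theorem familyOrbit_subset_image (hg : ∀ j, Function.Injective (g j)) {π : X → Y}
    (h : ∀ x j, ∃ i, π (f i x) = g j (π x)) {x : X} (hx : (familyOrbit f x).Finite) :
    familyOrbit g (π x) ⊆ π '' familyOrbit f x := by
  refine familyOrbit_subset hg (hx.image π) ?_ ⟨x, mem_familyOrbit_self f x, rfl⟩
  rintro j _ ⟨y, hy, rfl⟩
  obtain ⟨i, hi⟩ := h y j
  exact ⟨f i y, apply_mem_familyOrbit i hy, hi⟩

theorem encard_familyOrbit_le (hg : ∀ j, Function.Injective (g j)) {π : X → Y}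
    (h : ∀ x j, ∃ i, π (f i x) = g j (π x)) (x : X) :
    (familyOrbit g (π x)).encard ≤ (familyOrbit f x).encard := by
  by_cases hx : (familyOrbit f x).Finite
  · exact (Set.encard_le_encard (familyOrbit_subset_image hg h hx)).trans
      (Set.encard_image_le _ _)
  · rw [Set.Infinite.encard_eq hx]
    exact le_top

/-- The image of the first orbit covers the second; a finite set mapped onto one at least as large
is mapped injectively. -/
theorem injOn_familyOrbit (hg : ∀ j, Function.Injective (g j)) {π : X → Y}
    (h : ∀ x j, ∃ i, π (f i x) = g j (π x)) {x : X} (hx : (familyOrbit f x).Finite)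
    (hle : (familyOrbit f x).encard ≤ (familyOrbit g (π x)).encard) :
    Set.InjOn π (familyOrbit f x) :=
  hx.injOn_of_encard_image_eq (le_antisymm (Set.encard_image_le _ _)
    (hle.trans (Set.encard_le_encard (familyOrbit_subset_image hg h hx))))

end FamilyOrbit

/-! ### Periodic infinite words -/

namespace Stream'

variable {X : Type*}

theorem get_add_period {x : Stream' X} {L : ℕ} (h : x.drop L = x) (n : ℕ) :
    x.get (n + L) = x.get n := by
  conv_rhs => rw [← h]
  rfl

theorem drop_mul_period {x : Stream' X} {L : ℕ} (h : x.drop L = x) (n : ℕ) :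
    x.drop (L * n) = x := by
  induction n with
  | zero => rfl
  | succ n ih => rw [Nat.mul_succ, ← drop_drop, ih, h]

theorem eq_of_take_eq_of_period {x x' : Stream' X} {L : ℕ} (hL : 0 < L) (h : x.drop L = x)
    (h' : x'.drop L = x') (heq : x.take L = x'.take L) : x = x' := by
  ext n
  induction n using Nat.strong_induction_on with
  | _ n ih =>
    by_cases hn : n < L
    · have := getElem?_take (s := x) hn
      rw [heq, getElem?_take hn] at this
      exact (Option.some_injective _ this).symm
    · obtain ⟨k, rfl⟩ := Nat.exists_eq_add_of_le' (not_lt.1 hn)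
      rw [get_add_period h, get_add_period h', ih k (by omega)]

theorem drop_length_cycle (y : List X) (hy : y ≠ []) :
    (cycle y hy).drop y.length = cycle y hy := by
  conv_lhs => rw [cycle_eq]
  exact drop_append_stream _ _

theorem take_append_cycle (x y : List X) (hy : y ≠ []) (n : ℕ) :
    (x ++ₛ cycle y hy).take (x.length + y.length * n) =
      x ++ (List.replicate n y).flatten := by
  rw [← append_take]
  congr 1
  induction n with
  | zero => rfl
  | succ n ih =>
    rw [cycle_eq, Nat.mul_succ, Nat.add_comm, ← append_take, ih]
    rfl

theorem take_cycle (y : List X) (hy : y ≠ []) (n : ℕ) :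
    (cycle y hy).take (y.length * n) = (List.replicate n y).flatten := by
  simpa using take_append_cycle [] y hy n

end Stream'

/-! ### The action of letters on finite and infinite words of states -/

namespace Transducer

variable {S A : Type*} {D : Transducer S A}

theorem nextWord_append (D : Transducer S A) (u w : List S) (a : A) :
    D.nextWord (u ++ w) a = D.nextWord u a ++ D.nextWord w (D.outWord u a) := by
  induction u generalizing a with
  | nil => rfl
  | cons s u ih => simp [nextWord, outWord, ih]

theorem outWord_append (D : Transducer S A) (u w : List S) (a : A) :
    D.outWord (u ++ w) a = D.outWord w (D.outWord u a) := by
  induction u generalizing a with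
  | nil => rfl
  | cons s u ih => simp [outWord, ih]

theorem outWord_bijective (h : ∀ s, Function.Bijective (D.out s)) (w : List S) :
    Function.Bijective (D.outWord w) := by
  induction w with
  | nil => exact Function.bijective_id
  | cons s w ih => exact ih.comp (h s)

theorem nextWord_injective (h : ∀ a, Function.Injective fun s => D.next s a) (a : A) :
    Function.Injective fun w => D.nextWord w a := by
  intro u w huw
  induction u generalizing w a with
  | nil => cases w <;> simp_all [nextWord]
  | cons s u ih =>
    cases w with
    | nil => simp [nextWord] at huw
    | cons t w =>
      simp only [nextWord, List.cons.injEq] at huw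
      obtain rfl := h a huw.1
      rw [ih _ huw.2]

theorem take_nextWord (D : Transducer S A) (n : ℕ) (w : List S) (a : A) :
    (D.nextWord w a).take n = D.nextWord (w.take n) a := by
  induction n generalizing w a with
  | zero => rfl
  | succ n ih => cases w <;> simp [nextWord, ih]

theorem drop_nextWord (D : Transducer S A) (n : ℕ) (w : List S) (a : A) :
    (D.nextWord w a).drop n = D.nextWord (w.drop n) (D.outWord (w.take n) a) := by
  induction n generalizing w a with
  | zero => rfl
  | succ n ih => cases w <;> simp [nextWord, outWord, ih]

/-- The orbit of a word of states under the action of the letters. -/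
abbrev wordOrbit (D : Transducer S A) (w : List S) : Set (List S) :=
  familyOrbit (fun a w => D.nextWord w a) w

/-- The orbit of an infinite word of states under the action of the letters. -/
abbrev streamOrbit (D : Transducer S A) (v : Stream' S) : Set (Stream' S) :=
  familyOrbit D.dual.boundaryAct v

theorem finite_wordOrbit [Finite S] (h : ∀ a, Function.Injective fun s => D.next s a)
    (w : List S) : (D.wordOrbit w).Finite :=
  (List.finite_length_eq S w.length).subset
    (familyOrbit_subset (nextWord_injective h) (List.finite_length_eq S w.length)
      (fun a u hu => (D.length_nextWord u a).trans hu) rfl)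

theorem encard_wordOrbit_take_le (h : ∀ a, Function.Injective fun s => D.next s a) (n : ℕ)
    (w : List S) : (D.wordOrbit (w.take n)).encard ≤ (D.wordOrbit w).encard :=
  encard_familyOrbit_le (nextWord_injective h) (π := List.take n)
    (fun w a => ⟨a, D.take_nextWord n w a⟩) w

/-- The deleted prefix turns the acting letter `a` into its output, and this is a bijection of `A`;
every action on the suffix therefore lifts. -/
theorem encard_wordOrbit_drop_le (h : ∀ a, Function.Injective fun s => D.next s a)
    (h' : ∀ s, Function.Bijective (D.out s)) (n : ℕ)
    (w : List S) : (D.wordOrbit (w.drop n)).encard ≤ (D.wordOrbit w).encard := by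
  refine encard_familyOrbit_le (nextWord_injective h) (π := List.drop n) (fun w b => ?_) w
  obtain ⟨a, rfl⟩ := (outWord_bijective h' (w.take n)).2 b
  exact ⟨a, D.drop_nextWord n w a⟩

theorem run_dual (D : Transducer S A) (a : A) (v : Stream' S) (n : ℕ) :
    D.dual.run a v n = D.outWord (v.take n) a := by
  induction n with
  | zero => rfl
  | succ n ih =>
    rw [Stream'.take_succ', outWord_append, ← ih]
    rfl

theorem take_boundaryAct_dual (D : Transducer S A) (n : ℕ) (a : A) (v : Stream' S) :
    (D.dual.boundaryAct a v).take n = D.nextWord (v.take n) a := by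
  induction n with
  | zero => rfl
  | succ n ih =>
    rw [Stream'.take_succ', Stream'.take_succ', nextWord_append, ih, ← run_dual]
    rfl

theorem drop_boundaryAct_dual (D : Transducer S A) (n : ℕ) (a : A) (v : Stream' S) :
    (D.dual.boundaryAct a v).drop n =
      D.dual.boundaryAct (D.outWord (v.take n) a) (v.drop n) := by
  ext k
  change D.next (v.get (k + n)) (D.dual.run a v (k + n)) =
    D.next (v.get (k + n)) (D.dual.run _ (v.drop n) k)
  rw [run_dual, run_dual, ← outWord_append, ← Stream'.take_add, Nat.add_comm]

theorem boundaryAct_dual_injective (h : ∀ a, Function.Injective fun s => D.next s a) (a : A) :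
    Function.Injective (D.dual.boundaryAct a) := by
  intro u v huv
  refine Stream'.take_theorem _ _ fun n => nextWord_injective h a ?_
  simp only [← take_boundaryAct_dual, huv]

theorem encard_wordOrbit_take_le_streamOrbit (h : ∀ a, Function.Injective fun s => D.next s a)
    (n : ℕ) (v : Stream' S) : (D.wordOrbit (v.take n)).encard ≤ (D.streamOrbit v).encard :=
  encard_familyOrbit_le (nextWord_injective h) (π := Stream'.take n)
    (fun v a => ⟨a, D.take_boundaryAct_dual n a v⟩) v

theorem encard_streamOrbit_drop_le (h : ∀ a, Function.Injective fun s => D.next s a)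
    (h' : ∀ s, Function.Bijective (D.out s)) (n : ℕ) (v : Stream' S) :
    (D.streamOrbit (v.drop n)).encard ≤ (D.streamOrbit v).encard := by
  refine encard_familyOrbit_le (boundaryAct_dual_injective h) (π := Stream'.drop n)
    (fun v b => ?_) v
  obtain ⟨a, rfl⟩ := (outWord_bijective h' (v.take n)).2 b
  exact ⟨a, D.drop_boundaryAct_dual n a v⟩

/-- If no window of length `m` of an infinite word has fewer translates than the window of length
`m + 1` at the same place, then the infinite word has as many translates as its prefix of
length `m`. -/
theorem encard_streamOrbit_le_of_windows [Finite S]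
    (h : ∀ a, Function.Injective fun s => D.next s a) (m : ℕ) (v : Stream' S)
    (hv : ∀ l, (D.wordOrbit ((v.drop l).take (m + 1))).encard ≤
      (D.wordOrbit ((v.drop l).take m)).encard) :
    (D.streamOrbit v).encard ≤ (D.wordOrbit (v.take m)).encard := by
  -- The numbers of translates agree, so the last letter of a translated window is a function of the
  -- other `m`.
  have hinj (l : ℕ) : Set.InjOn (List.take m) (D.wordOrbit ((v.drop l).take (m + 1))) := by
    refine injOn_familyOrbit (nextWord_injective h) (fun w a => ⟨a, D.take_nextWord m w a⟩)
      (finite_wordOrbit h _) ?_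
    simpa using hv l
  have hmem (l : ℕ) {x : Stream' S} (hx : x ∈ D.streamOrbit v) :
      (x.drop l).take (m + 1) ∈ D.wordOrbit ((v.drop l).take (m + 1)) :=
    mapsTo_familyOrbit (π := fun x : Stream' S => (x.drop l).take (m + 1)) (fun x a =>
      ⟨D.outWord (x.take l) a, by simp only [drop_boundaryAct_dual, take_boundaryAct_dual]⟩) v hx
  have hinj' : Set.InjOn (Stream'.take m) (D.streamOrbit v) := by
    intro x hx x' hx' hxx
    -- Agreement on the `m` letters from `l` forces agreement on the next one, hence on the `m`
    -- letters from `l + 1`.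
    have key (l : ℕ) : (x.drop l).take m = (x'.drop l).take m := by
      induction l with
      | zero => exact hxx
      | succ l ih =>
        have := hinj l (hmem l hx) (hmem l hx') (by simpa using ih)
        rw [Stream'.take_succ, Stream'.take_succ] at this
        simpa using (List.cons.inj this).2
    ext l
    have := hinj l (hmem l hx) (hmem l hx') (by simpa using key l)
    rw [Stream'.take_succ, Stream'.take_succ] at this
    simpa using (List.cons.inj this).1
  rw [← hinj'.encard_image]
  exact Set.encard_le_encard (mapsTo_familyOrbit (π := Stream'.take m)
    (fun x a => ⟨a, D.take_boundaryAct_dual m a x⟩) v).image_subset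

end Transducer

/-! ### Schreier graphs and the growth function as orbit sizes -/

namespace Transducer

variable {Q A : Type*} (T : Transducer Q A)

section WithInverse

variable (h : T.IsInvertible)

theorem out_inverse_out (s : Q × Bool) (a : A) :
    (T.withInverse h).out (s.1, !s.2) ((T.withInverse h).out s a) = a := by
  obtain ⟨q, _ | _⟩ := s
  · exact (T.outEquiv h q).apply_symm_apply a
  · exact (T.outEquiv h q).symm_apply_apply a

theorem next_inverse_out (s : Q × Bool) (a : A) :
    (T.withInverse h).next (s.1, !s.2) ((T.withInverse h).out s a) =
      (((T.withInverse h).next s a).1, !s.2) := by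
  obtain ⟨q, _ | _⟩ := s
  · rfl
  · exact congrArg (fun b => (T.next q b, false)) ((T.outEquiv h q).symm_apply_apply a)

theorem snd_next_withInverse (s : Q × Bool) (a : A) :
    ((T.withInverse h).next s a).2 = s.2 := rfl

theorem bijective_out_withInverse (s : Q × Bool) :
    Function.Bijective ((T.withInverse h).out s) := by
  obtain ⟨q, _ | _⟩ := s
  · exact (T.outEquiv h q).symm.bijective
  · exact (T.outEquiv h q).bijective

end WithInverse

theorem enrichedDual_eq [Finite A] (hT : T.IsBireversible) :
    T.enrichedDual hT = (T.withInverse hT.isInvertible).dual := by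
  have h1 : (T.enrichedDual hT).next = (T.withInverse hT.isInvertible).dual.next := by
    funext a ⟨q, b⟩
    cases b <;> rfl
  have h2 : (T.enrichedDual hT).out = (T.withInverse hT.isInvertible).dual.out := by
    funext a ⟨q, b⟩
    cases b <;> rfl
  cases h3 : T.enrichedDual hT
  cases h4 : (T.withInverse hT.isInvertible).dual
  simp_all

/-- This is the invertibility of the enriched dual; it is where bireversibility enters the orbit
arguments. -/
theorem next_withInverse_injective [Finite A] (hT : T.IsBireversible) (a : A) :
    Function.Injective fun s => (T.withInverse hT.isInvertible).next s a := by
  have := (T.enrichedDual_isInvertible hT a).1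
  rwa [enrichedDual_eq] at this

theorem schreierSize_eq [Finite A] (hT : T.IsBireversible) (v : Stream' (Q × Bool)) :
    T.schreierSize hT v = ((T.withInverse hT.isInvertible).streamOrbit v).encard := by
  have hf : (T.enrichedDual hT).boundaryAct = (T.withInverse hT.isInvertible).dual.boundaryAct := by
    rw [enrichedDual_eq]
  unfold schreierSize LabelledDigraph.size streamOrbit
  congr 1
  rw [← hf]
  ext w
  constructor
  · intro hw
    change Relation.EqvGen _ _ _ at hw
    change Relation.EqvGen _ _ _
    induction hw with
    | rel x y hxy =>
      obtain ⟨⟨a, b⟩, hl⟩ := hxy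
      cases b
      · refine Relation.EqvGen.symm _ _ (Relation.EqvGen.rel _ _ ⟨a, ?_⟩)
        exact (inv_smul_eq_iff.1 (show (_)⁻¹ • x = y from hl)).symm
      · exact Relation.EqvGen.rel _ _ ⟨a, hl⟩
    | refl => exact Relation.EqvGen.refl _
    | symm _ _ _ ih => exact ih.symm
    | trans _ _ _ _ _ ih₁ ih₂ => exact ih₁.trans _ _ _ ih₂
  · intro hw
    exact Relation.EqvGen.mono (fun x y hxy => hxy.elim fun a ha => ⟨(a, true), ha⟩) _ _ hw

theorem size_pow_digraph {S : Type*} (D : Transducer S A) (n : ℕ) (w : List.Vector S n) :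
    ((D.pow n).digraph.size w) = (D.wordOrbit w.1).encard := by
  have hV : (D.pow n).digraph.component w = familyOrbit (fun a w => (D.pow n).next w a) w := by
    have : (fun x y => ∃ l, (D.pow n).digraph.Edge x l y) =
        fun x y => ∃ a, (D.pow n).next x a = y := by
      funext x y
      exact propext ⟨fun ⟨l, hl⟩ => ⟨l.1, hl.1⟩,
        fun ⟨a, ha⟩ => ⟨(a, (D.pow n).out x a), ha, rfl⟩⟩
    unfold LabelledDigraph.component familyOrbit
    rw [this]
  rw [LabelledDigraph.size, hV]
  have himg : (fun x : List.Vector S n => x.1) '' familyOrbit (fun a w => (D.pow n).next w a) w =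
      D.wordOrbit w.1 := by
    refine Set.Subset.antisymm
      (mapsTo_familyOrbit (π := fun x : List.Vector S n => x.1)
        (fun x a => ⟨a, rfl⟩) w).image_subset fun y hy => ?_
    -- Letters preserve length, so a chain of words that starts in length `n` lifts to vectors.
    have key : ∀ x y, Relation.EqvGen (fun x y => ∃ a, D.nextWord x a = y) x y →
        ∃ e : x.length = y.length, ∀ hx : x.length = n,
          Relation.EqvGen (fun x y => ∃ a, (D.pow n).next x a = y) ⟨x, hx⟩
            ⟨y, e.symm.trans hx⟩ := by
      intro x y hxy
      induction hxy with
      | rel x y hxy =>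
        obtain ⟨a, rfl⟩ := hxy
        exact ⟨(D.length_nextWord x a).symm, fun hx => Relation.EqvGen.rel _ _ ⟨a, rfl⟩⟩
      | refl x => exact ⟨rfl, fun hx => Relation.EqvGen.refl _⟩
      | symm x y _ ih =>
        obtain ⟨e, he⟩ := ih
        exact ⟨e.symm, fun hx => (he (e.trans hx)).symm⟩
      | trans x y z _ _ ih₁ ih₂ =>
        obtain ⟨e₁, he₁⟩ := ih₁
        obtain ⟨e₂, he₂⟩ := ih₂
        exact ⟨e₁.trans e₂, fun hx => (he₁ hx).trans _ _ _ (he₂ (e₁.symm.trans hx))⟩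
    obtain ⟨e, he⟩ := key _ _ hy
    exact ⟨⟨y, e.symm.trans w.2⟩, he w.2, rfl⟩
  have hval : Function.Injective fun x : List.Vector S n => x.1 := Subtype.val_injective
  rw [← himg, hval.injOn.encard_image]

section Chi

variable {T}

theorem chi_le (h : T.IsInvertible) {w : List (Q × Bool)} (hw : FreeGroup.IsReduced w) :
    T.chi h w.length ≤ ((T.withInverse h).wordOrbit w).encard := by
  rw [chi]
  refine (iInf_le _ ⟨⟨w, rfl⟩, hw⟩).trans_eq ?_
  rw [size_pow_digraph]

theorem exists_chi_eq [Nonempty Q] (h : T.IsInvertible) (n : ℕ) :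
    ∃ w : List (Q × Bool), w.length = n ∧ FreeGroup.IsReduced w ∧
      T.chi h n = ((T.withInverse h).wordOrbit w).encard := by
  obtain ⟨q⟩ := ‹Nonempty Q›
  have : Nonempty {w : List.Vector (Q × Bool) n // FreeGroup.IsReduced w.1} :=
    ⟨⟨⟨List.replicate n (q, true), by simp⟩,
      List.isChain_replicate_of_rel _ fun _ => rfl⟩⟩
  obtain ⟨w, hw⟩ := ciInf_mem fun w : {w : List.Vector (Q × Bool) n // FreeGroup.IsReduced w.1} =>
    ((T.withInverse h).pow n).digraph.size w.1
  refine ⟨w.1.1, w.1.2, w.2, ?_⟩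
  exact hw.symm.trans (size_pow_digraph _ _ _)

theorem chi_mono [Nonempty Q] [Finite A] (hT : T.IsBireversible) :
    Monotone (T.chi hT.isInvertible) := by
  intro m n hmn
  obtain ⟨w, rfl, hw, hχ⟩ := exists_chi_eq hT.isInvertible n
  rw [hχ]
  refine le_trans ?_ (encard_wordOrbit_take_le (T.next_withInverse_injective hT) m w)
  have := chi_le hT.isInvertible (hw.infix (List.take_prefix m w).isInfix)
  rwa [List.length_take_of_le hmn] at this

theorem chi_lt_top [Finite Q] [Nonempty Q] [Finite A] (hT : T.IsBireversible) (m : ℕ) : T.chi hT.isInvertible m < ⊤ := by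
  obtain ⟨w, -, -, hw⟩ := exists_chi_eq hT.isInvertible m
  rw [hw, Set.encard_lt_top_iff]
  exact finite_wordOrbit (T.next_withInverse_injective hT) w

/-- If the images of neighbours `s`, `t` cancelled, `t` and `s⁻¹` would reach the same state on
reading the output of `s`; injectivity then gives `t = s⁻¹`. -/
theorem isReduced_nextWord [Finite A] (hT : T.IsBireversible) {w : List (Q × Bool)}
    (hw : FreeGroup.IsReduced w) (a : A) :
    FreeGroup.IsReduced ((T.withInverse hT.isInvertible).nextWord w a) := by
  induction w generalizing a with
  | nil => exact hw
  | cons s w ih =>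
    cases w with
    | nil => exact FreeGroup.IsReduced.singleton
    | cons t w =>
      obtain ⟨hst, hw⟩ := FreeGroup.isReduced_cons_cons.1 hw
      refine FreeGroup.isReduced_cons_cons.2 ⟨fun heq => ?_, ih hw _⟩
      by_contra hne
      have ht : t = (s.1, !s.2) := by
        refine T.next_withInverse_injective hT
          ((T.withInverse hT.isInvertible).out s a) ?_
        change _ = (T.withInverse hT.isInvertible).next (s.1, !s.2) _
        rw [next_inverse_out]
        refine Prod.ext heq.symm ?_
        rw [snd_next_withInverse, snd_next_withInverse] at hne
        change t.2 = !s.2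
        revert hne
        cases s.2 <;> cases t.2 <;> simp
      have := hst (by rw [ht])
      rw [ht] at this
      revert this
      cases s.2 <;> simp

/-- A pair `s s⁻¹` goes to a cancelling pair and returns the letter it reads, so the rest of the
word is acted on as if the pair were absent. -/
theorem red_nextWord (h : T.IsInvertible) {u w : List (Q × Bool)}
    (hr : FreeGroup.Red u w) (a : A) :
    FreeGroup.Red ((T.withInverse h).nextWord u a) ((T.withInverse h).nextWord w a) := by
  induction hr with
  | refl => exact Relation.ReflTransGen.refl
  | tail _ hs ih =>
    refine ih.tail ?_
    obtain @⟨u, w, q, b⟩ := hs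
    rw [nextWord_append, nextWord_append]
    simp only [nextWord]
    rw [T.next_inverse_out h (q, b), T.out_inverse_out h (q, b)]
    exact FreeGroup.Red.Step.not

theorem reduce_nextWord [Finite A] [DecidableEq Q] (hT : T.IsBireversible)
    (w : List (Q × Bool)) (a : A) :
    FreeGroup.reduce ((T.withInverse hT.isInvertible).nextWord w a) =
      (T.withInverse hT.isInvertible).nextWord (FreeGroup.reduce w) a := by
  rw [FreeGroup.reduce.eq_of_red (red_nextWord hT.isInvertible FreeGroup.reduce.red a)]
  exact (isReduced_nextWord hT (FreeGroup.isReduced_iff_reduce_eq.2 FreeGroup.reduce.idem)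
    a).reduce_eq

/-- Free reduction is equivariant, so it maps the orbit of `w` onto that of its reduced form. -/
theorem chi_length_reduce_le [Finite A] [DecidableEq Q] (hT : T.IsBireversible)
    (w : List (Q × Bool)) :
    T.chi hT.isInvertible (FreeGroup.reduce w).length ≤
      ((T.withInverse hT.isInvertible).wordOrbit w).encard :=
  (chi_le hT.isInvertible (FreeGroup.isReduced_iff_reduce_eq.2 FreeGroup.reduce.idem)).trans
    (encard_familyOrbit_le (nextWord_injective (T.next_withInverse_injective hT))
      (π := FreeGroup.reduce) (fun w a => ⟨a, reduce_nextWord hT w a⟩) w)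

theorem chi_length_reduce_take_le [Finite A] [DecidableEq Q] (hT : T.IsBireversible)
    (v : Stream' (Q × Bool)) (n : ℕ) :
    T.chi hT.isInvertible (FreeGroup.reduce (v.take n)).length ≤ T.schreierSize hT v := by
  rw [schreierSize_eq]
  exact (chi_length_reduce_le hT _).trans
    (encard_wordOrbit_take_le_streamOrbit (T.next_withInverse_injective hT) n v)

end Chi

end Transducer

/-! ### Unbounded reduced length along `xyⁿ` -/

theorem FreeGroup.mk_flatten_replicate {Q : Type*} (y : List (Q × Bool)) (n : ℕ) :
    mk (List.replicate n y).flatten = mk y ^ n := by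
  induction n with
  | zero => rfl
  | succ n ih => rw [List.replicate_succ, List.flatten_cons, ← mul_mk, ih, pow_succ']

/-- Free groups are torsion-free, so the elements `xyⁿ` are pairwise distinct, while only finitely
many words are shorter than `N`. -/
theorem FreeGroup.exists_le_length_reduce {Q : Type*} [Finite Q] [DecidableEq Q]
    {x y : List (Q × Bool)} (hy : y ≠ []) (hxy : FreeGroup.reduce (x ++ y) = x ++ y) (N : ℕ) :
    ∃ n, N ≤ (FreeGroup.reduce (x ++ (List.replicate n y).flatten)).length := by
  by_contra! hlt
  have hyr : FreeGroup.reduce y = y :=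
    ((isReduced_iff_reduce_eq.2 hxy).infix (List.suffix_append x y).isInfix).reduce_eq
  have hy1 : mk y ≠ 1 := by
    intro h
    rw [← toWord_eq_nil_iff, toWord_mk, hyr] at h
    exact hy h
  have hfin : {w : List (Q × Bool) | w.length < N}.Finite := List.finite_length_lt _ N
  refine Set.infinite_of_injective_forall_mem (fun m n hmn => ?_) hlt hfin
  have := reduce.exact hmn
  rw [← mul_mk, ← mul_mk, mk_flatten_replicate, mk_flatten_replicate] at this
  exact injective_pow_iff_not_isOfFinOrder.2 (not_isOfFinOrder_of_isMulTorsionFree hy1)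
    (mul_left_cancel this)

namespace Transducer

theorem chi_le_schreierSize {Q A : Type*} [Finite Q] [Nonempty Q] [DecidableEq Q] [Finite A]
    {T : Transducer Q A} (hT : T.IsBireversible) {x y : List (Q × Bool)} (hy : y ≠ [])
    (hxy : FreeGroup.reduce (x ++ y) = x ++ y) (N : ℕ) :
    T.chi hT.isInvertible N ≤
      T.schreierSize hT (Stream'.appendStream' x (Stream'.cycle y hy)) := by
  obtain ⟨n, hn⟩ := FreeGroup.exists_le_length_reduce hy hxy N
  refine (chi_mono hT hn).trans ?_
  rw [← Stream'.take_append_cycle x y hy n]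
  exact chi_length_reduce_take_le hT _ _

end Transducer

/-! ### Pigeonhole on windows and the stationary case -/

/-- If the windows of length `m` of a finite word at the places `i < j` are equal, then all windows
of length `m + 1` of the ultimately periodic word obtained by repeating the factor between `i` and
`j` are windows of the finite word. -/
theorem Stream'.exists_window_append_cycle {X : Type*} {u : List X} {i j m : ℕ} (hij : i < j)
    (hj : j + m ≤ u.length) (hw : (u.drop i).take m = (u.drop j).take m)
    (hy : (u.drop i).take (j - i) ≠ []) (l : ℕ) :
    ∃ l' < j, (((u.take i ++ₛ cycle ((u.drop i).take (j - i)) hy).drop l).take (m + 1) =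
      (u.drop l').take (m + 1)) := by
  set v := u.take i ++ₛ cycle ((u.drop i).take (j - i)) hy with hv
  have hlx : (u.take i).length = i := List.length_take_of_le (by omega)
  have hly : ((u.drop i).take (j - i)).length = j - i :=
    List.length_take_of_le (by rw [List.length_drop]; omega)
  have hper (n : ℕ) (hn : i ≤ n) : v.get (n + (j - i)) = v.get n := by
    have hd : (v.drop i).drop (j - i) = v.drop i := by
      have : v.drop i = cycle ((u.drop i).take (j - i)) hy := by
        conv_lhs => rw [← hlx]
        exact drop_append_stream _ _
      have hc := drop_length_cycle _ hy
      rwa [hly, ← this] at hc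
    have := get_add_period hd (n - i)
    rw [get_drop, get_drop] at this
    convert this using 2 <;> omega
  have hfst (n : ℕ) (hn : n < j) : u[n]? = some (v.get n) := by
    have ht : v.take j = u.take j := by
      have := take_append_cycle (u.take i) _ hy 1
      rw [hlx, hly, Nat.mul_one, Nat.add_sub_of_le hij.le] at this
      rw [this]
      simp only [List.replicate_one, List.flatten_singleton]
      rw [← List.take_add, Nat.add_sub_of_le hij.le]
    rw [← List.getElem?_take_of_lt hn, ← ht, getElem?_take hn]
  -- Beyond `j`, the equality of the windows at `i` and `j` gives `u` the same period `j - i` as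
  -- `v`.
  have hget (n : ℕ) (hn : n < j + m) : u[n]? = some (v.get n) := by
    induction n using Nat.strong_induction_on with
    | _ n ih =>
      by_cases hnj : n < j
      · exact hfst n hnj
      · obtain ⟨k, rfl⟩ := Nat.exists_eq_add_of_le (not_lt.1 hnj)
        have h1 : u[i + k]? = u[j + k]? := by
          have := congrArg (fun w : List X => w[k]?) hw
          simpa [List.getElem?_take, show k < m by omega] using this
        rw [← h1, ih (i + k) (by omega) (by omega), ← hper (i + k) (by omega)]
        congr 2
        omega
  -- Subtracting periods brings any place below `j`; a window of length `m + 1` starting there ends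
  -- before `j + m`, where `u` and `v` still agree.
  have hred (l : ℕ) : ∃ l' < j, ∀ n, v.get (l + n) = v.get (l' + n) := by
    induction l using Nat.strong_induction_on with
    | _ l ih =>
      by_cases hlj : l < j
      · exact ⟨l, hlj, fun _ => rfl⟩
      · obtain ⟨l', hl', h⟩ := ih (l - (j - i)) (by omega)
        refine ⟨l', hl', fun n => ?_⟩
        rw [← h n, ← hper (l - (j - i) + n) (by omega)]
        congr 1
        omega
  obtain ⟨l', hl', h⟩ := hred l
  refine ⟨l', hl', List.ext_getElem? fun n => ?_⟩
  by_cases hn : n < m + 1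
  · rw [getElem?_take hn, get_drop, h, List.getElem?_take_of_lt hn, List.getElem?_drop,
      hget _ (by omega)]
  · rw [List.getElem?_eq_none (by simpa using hn),
      List.getElem?_eq_none (by rw [List.length_take]; omega)]

theorem isReducedStream_of_windows {Q : Type*} {v : Stream' (Q × Bool)} {m : ℕ} (hm : 1 ≤ m)
    (h : ∀ l, FreeGroup.IsReduced ((v.drop l).take (m + 1))) : IsReducedStream v := by
  intro n
  refine List.isChain_iff_getElem.2 fun l hl => ?_
  -- Reducedness concerns adjacent letters only, and `1 ≤ m` makes the windows long enough to
  -- contain them.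
  have h2 : FreeGroup.IsReduced ((v.drop l).take 2) :=
    (h l).infix (Stream'.take_prefix_take_left 2 (m + 1) _ (by omega)).isInfix
  have := List.isChain_iff_getElem.1 h2 0 (by simp)
  simpa [Stream'.take_get, Stream'.get_drop] using this

theorem exists_eq_windows {X : Type*} [Fintype X] {u : List X} {m B : ℕ}
    (hu : u.length = m + B) (hB : Fintype.card X ^ m ≤ B) :
    ∃ i j, i < j ∧ j ≤ B ∧ (u.drop i).take m = (u.drop j).take m := by
  let f : Fin (B + 1) → List.Vector X m := fun l => ⟨(u.drop l).take m,
    List.length_take_of_le (by rw [List.length_drop]; omega)⟩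
  obtain ⟨i, j, hij, hf⟩ := Fintype.exists_ne_map_eq_of_card_lt f
    (by rw [card_vector, Fintype.card_fin]; omega)
  have hf := congrArg Subtype.val hf
  rcases lt_or_gt_of_ne hij with h | h
  · exact ⟨i, j, h, by omega, hf⟩
  · exact ⟨j, i, h, by omega, hf.symm⟩

namespace Transducer

variable {Q A : Type*} {T : Transducer Q A}

theorem encard_wordOrbit_of_isEmpty {S : Type*} [IsEmpty A] (D : Transducer S A) (w : List S) :
    (D.wordOrbit w).encard = 1 := by
  refine le_antisymm ?_ (one_le_encard_familyOrbit _ _)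
  rw [← Set.encard_singleton w]
  exact Set.encard_le_encard (familyOrbit_subset isEmptyElim (Set.finite_singleton w)
    isEmptyElim rfl)

theorem exists_periodic_of_chi_eq [Fintype Q] [Nonempty Q] [Fintype A]
    (hT : T.IsBireversible) {m : ℕ} (hm : 1 ≤ m)
    (hχ : ∀ i ≤ (2 ^ m * Fintype.card A * Fintype.card Q ^ m) ^ Fintype.card A,
        T.chi hT.isInvertible m = T.chi hT.isInvertible (m + i)) :
    ∃ (x y : List (Q × Bool)) (hy : y ≠ []),
      IsReducedStream (Stream'.appendStream' x (Stream'.cycle y hy)) ∧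
      x.length + y.length ≤
        m + (2 ^ m * Fintype.card A * Fintype.card Q ^ m) ^ Fintype.card A ∧
      T.schreierSize hT (Stream'.appendStream' x (Stream'.cycle y hy)) =
        T.chi hT.isInvertible m := by
  set B := (2 ^ m * Fintype.card A * Fintype.card Q ^ m) ^ Fintype.card A with hB
  set D := T.withInverse hT.isInvertible with hD
  have hD1 : ∀ a, Function.Injective fun s => D.next s a := T.next_withInverse_injective hT
  have hD2 : ∀ s, Function.Bijective (D.out s) := T.bijective_out_withInverse hT.isInvertible
  obtain ⟨u, i, j, hlen, hur, hus, hij, hj, hw⟩ : ∃ (u : List (Q × Bool)) (i j : ℕ),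
      u.length = m + B ∧ FreeGroup.IsReduced u ∧
      (D.wordOrbit u).encard = T.chi hT.isInvertible m ∧ i < j ∧ j ≤ B ∧
      (u.drop i).take m = (u.drop j).take m := by
    rcases isEmpty_or_nonempty A with hA | hA
    · obtain ⟨q⟩ := ‹Nonempty Q›
      -- With no letters the exponent is `0`, so `B = 1` and the pigeonhole bound may fail; but all
      -- orbits are singletons and a constant word has equal windows at `0` and `1`.
      have hB1 : B = 1 := by simp [hB]
      refine ⟨List.replicate (m + B) (q, true), 0, 1, List.length_replicate,
        List.isChain_replicate_of_rel _ fun _ => rfl, ?_, one_pos, hB1.ge, ?_⟩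
      · obtain ⟨w, -, -, hw⟩ := exists_chi_eq hT.isInvertible m
        rw [hw, encard_wordOrbit_of_isEmpty, encard_wordOrbit_of_isEmpty]
      · simp [hB1]
    · obtain ⟨u, hlen, hur, hus⟩ := exists_chi_eq hT.isInvertible (m + B)
      have hk : 0 < Fintype.card A := Fintype.card_pos
      obtain ⟨i, j, hij, hj, hw⟩ := exists_eq_windows hlen (by
        rw [Fintype.card_prod, Fintype.card_bool, mul_comm, mul_pow]
        calc 2 ^ m * Fintype.card Q ^ m ≤ 2 ^ m * Fintype.card A * Fintype.card Q ^ m := by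
              gcongr
              exact Nat.le_mul_of_pos_right _ hk
          _ ≤ B := Nat.le_self_pow hk.ne' _)
      exact ⟨u, i, j, hlen, hur, by rw [hχ B le_rfl, hus], hij, hj, hw⟩
  have hlx : (u.take i).length = i := List.length_take_of_le (by omega)
  have hly : ((u.drop i).take (j - i)).length = j - i :=
    List.length_take_of_le (by rw [List.length_drop]; omega)
  have hy : (u.drop i).take (j - i) ≠ [] := List.ne_nil_of_length_pos (by omega)
  have hwin := Stream'.exists_window_append_cycle hij (by omega) hw hy
  set v := Stream'.appendStream' (u.take i) (Stream'.cycle ((u.drop i).take (j - i)) hy) with hv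
  have hred (l : ℕ) : FreeGroup.IsReduced ((v.drop l).take (m + 1)) := by
    obtain ⟨l', -, hl'⟩ := hwin l
    rw [hl']
    exact hur.infix ((List.take_prefix _ _).isInfix.trans (List.drop_suffix _ _).isInfix)
  -- Each window occurs in `u`, whose orbit has `χ(m + B) = χ(m)` points; `hge` is the opposite
  -- bound, from minimality of `χ(m)`.
  have hle (l : ℕ) :
      (D.wordOrbit ((v.drop l).take (m + 1))).encard ≤ T.chi hT.isInvertible m := by
    obtain ⟨l', -, hl'⟩ := hwin l
    rw [hl', ← hus]
    exact (encard_wordOrbit_take_le hD1 _ _).trans (encard_wordOrbit_drop_le hD1 hD2 _ _)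
  have htake (l : ℕ) : ((v.drop l).take (m + 1)).take m = (v.drop l).take m := by simp
  have hge (l : ℕ) :
      T.chi hT.isInvertible m ≤ (D.wordOrbit ((v.drop l).take m)).encard := by
    have := chi_le hT.isInvertible ((hred l).infix (List.take_prefix m _).isInfix)
    rwa [htake, Stream'.length_take] at this
  refine ⟨_, _, hy, isReducedStream_of_windows hm hred, by omega, ?_⟩
  rw [schreierSize_eq]
  refine le_antisymm ?_ ((hge 0).trans (encard_wordOrbit_take_le_streamOrbit hD1 m v))
  refine (encard_streamOrbit_le_of_windows hD1 m v fun l => (hle l).trans (hge l)).trans ?_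
  have := encard_wordOrbit_take_le hD1 m ((v.drop 0).take (m + 1))
  rw [htake] at this
  exact this.trans (hle 0)

end Transducer

/-! ### Finite orbits of periodic words and torsion -/

namespace Transducer

section ActWord

variable {S A : Type*} {D : Transducer S A}

/-- The action of a word of states `s₁ … sₙ` on finite words, in which `s₁` acts first. -/
def actWord (D : Transducer S A) (w : List S) (u : List A) : List A :=
  w.foldl (fun u s => D.act s u) u

theorem actWord_nil_right (D : Transducer S A) (w : List S) : D.actWord w [] = [] := by
  induction w with
  | nil => rfl
  | cons s w ih => exact ih

theorem actWord_cons_right (D : Transducer S A) (w : List S) (a : A) (u : List A) :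
    D.actWord w (a :: u) = D.outWord w a :: D.actWord (D.nextWord w a) u := by
  induction w generalizing a u with
  | nil => rfl
  | cons s w ih => exact ih _ _

/-- The `L`-periodic words whose block of length `L` acts trivially form a finite set, stable under
the letters. -/
theorem finite_streamOrbit_of_period [Finite S]
    (h : ∀ a, Function.Injective fun s => D.next s a) {v : Stream' S} {L : ℕ} (hL : 0 < L)
    (hv : v.drop L = v) (hact : ∀ u, D.actWord (v.take L) u = u) :
    (D.streamOrbit v).Finite := by
  let P : Set (Stream' S) := {x | x.drop L = x ∧ ∀ u, D.actWord (x.take L) u = u}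
  have hP : P.Finite := by
    refine Set.Finite.of_finite_image (f := Stream'.take L)
      ((List.finite_length_eq S L).subset ?_) fun x hx x' hx' hxx =>
        Stream'.eq_of_take_eq_of_period hL hx.1 hx'.1 hxx
    rintro _ ⟨x, -, rfl⟩
    exact Stream'.length_take _ _
  refine hP.subset (familyOrbit_subset (boundaryAct_dual_injective h) hP ?_ ⟨hv, hact⟩)
  rintro a x ⟨hx, hxact⟩
  -- The head says that the block returns `a`, so the period survives; the tail says that the
  -- translated block again acts trivially.
  have hcons (u : List A) := (D.actWord_cons_right (x.take L) a u).symm.trans (hxact (a :: u))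
  refine ⟨?_, fun u => ?_⟩
  · rw [drop_boundaryAct_dual, hx, (List.cons.inj (hcons [])).1]
  · rw [take_boundaryAct_dual]
    exact (List.cons.inj (hcons u)).2

theorem outWord_take_mul_of_period {x : Stream' S} {L : ℕ} (h : x.drop L = x) (n : ℕ) :
    D.outWord (x.take (L * n)) = (D.outWord (x.take L))^[n] := by
  induction n with
  | zero => rfl
  | succ n ih =>
    rw [Function.iterate_succ', ← ih, Nat.mul_succ, Stream'.take_add,
      Stream'.drop_mul_period h]
    funext a
    exact D.outWord_append _ _ a

/-- The order of the symmetric group serves as a common exponent. -/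
theorem exists_iterate_eq_id (A : Type*) [Finite A] :
    ∃ N, 0 < N ∧ ∀ f : A → A, Function.Bijective f → f^[N] = id := by
  refine ⟨Nat.card (Equiv.Perm A), Nat.card_pos, fun f hf => ?_⟩
  change (Equiv.ofBijective f hf)^[_] = id
  rw [Equiv.Perm.iterate_eq_pow, pow_card_eq_one']
  rfl

theorem exists_period_of_finite_streamOrbit [Finite A]
    (h : ∀ a, Function.Injective fun s => D.next s a)
    (h' : ∀ s, Function.Bijective (D.out s)) {v : Stream' S} (hfin : (D.streamOrbit v).Finite)
    {L : ℕ} (hL : 0 < L) (hv : v.drop L = v) :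
    ∃ n, 0 < n ∧ ∀ u, D.actWord (v.take (L * n)) u = u := by
  obtain ⟨N, hN, hNid⟩ := exists_iterate_eq_id A
  have hout {x : Stream' S} {K : ℕ} (hx : x.drop K = x) (a : A) :
      D.outWord (x.take (K * N)) a = a := by
    rw [outWord_take_mul_of_period hx, hNid _ (outWord_bijective h' _), id]
  have hper : ∀ x ∈ D.streamOrbit v, ∃ K, 0 < K ∧ x.drop K = x := by
    -- If `x` has period `K`, then `N` blocks of length `K` return every letter, so each translate
    -- of `x` has period `K * N`.
    have hsub : D.streamOrbit v ⊆ D.streamOrbit v ∩ {x | ∃ K, 0 < K ∧ x.drop K = x} := by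
      refine familyOrbit_subset (boundaryAct_dual_injective h)
        (hfin.subset Set.inter_subset_left) ?_ ⟨mem_familyOrbit_self _ _, L, hL, hv⟩
      rintro a x ⟨hx, K, hK, hxK⟩
      refine ⟨apply_mem_familyOrbit a hx, K * N, Nat.mul_pos hK hN, ?_⟩
      rw [drop_boundaryAct_dual, hout hxK, Stream'.drop_mul_period hxK]
    exact fun x hx => (hsub hx).2
  choose! K hK hxK using hper
  -- A common period of the finitely many points of the orbit.
  let M := ∏ x ∈ hfin.toFinset, K x
  have hM : 0 < M := Finset.prod_pos fun x hx => hK x (hfin.mem_toFinset.1 hx)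
  have hxM : ∀ x ∈ D.streamOrbit v, x.drop M = x := by
    intro x hx
    obtain ⟨c, hc⟩ := Finset.dvd_prod_of_mem K (hfin.mem_toFinset.2 hx)
    change x.drop (∏ x ∈ hfin.toFinset, K x) = x
    rw [hc]
    exact Stream'.drop_mul_period (hxK x hx) c
  -- The induction runs over all points at once: the first letter is fixed thanks to the factor `N`,
  -- and the remaining letters are read by the same-length prefix of another point of the orbit.
  have key (u : List A) : ∀ x ∈ D.streamOrbit v, D.actWord (x.take (L * (M * N))) u = u := by
    induction u with
    | nil => exact fun x _ => D.actWord_nil_right _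
    | cons a u ih =>
      intro x hx
      have hxL : x.drop (L * M) = x := by
        rw [mul_comm]
        exact Stream'.drop_mul_period (hxM x hx) L
      rw [actWord_cons_right, ← take_boundaryAct_dual, ih _ (apply_mem_familyOrbit a hx),
        ← mul_assoc, hout hxL]
  exact ⟨M * N, Nat.mul_pos hM hN, fun u => key u v (mem_familyOrbit_self _ _)⟩

end ActWord

variable {Q A : Type*} {T : Transducer Q A}

/-- The reversal appears because a product of permutations applies its right factor first, whereas
in `actWord` the first state acts first. -/
theorem coe_presentation_mk (h : T.IsInvertible) (w : List (Q × Bool)) (u : List A) :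
    ((T.presentation h (FreeGroup.mk w) : T.automatonGroup h) : Equiv.Perm (List A)) u =
      (T.withInverse h).actWord w.reverse u := by
  have htrue (q : Q) : (T.withInverse h).act (q, true) = T.act q := by
    funext u
    induction u generalizing q with
    | nil => rfl
    | cons a u ih => exact congrArg (T.out q a :: ·) (ih _)
  have hfalse (q : Q) : (T.withInverse h).act (q, false) = (T.inverse h).act q := by
    funext u
    induction u generalizing q with
    | nil => rfl
    | cons a u ih => exact congrArg ((T.inverse h).out q a :: ·) (ih _)
  induction w with
  | nil => rfl
  | cons s w ih =>
    have hcons : FreeGroup.mk (s :: w) = FreeGroup.mk [s] * FreeGroup.mk w := rfl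
    rw [hcons, map_mul, Subgroup.coe_mul, Equiv.Perm.mul_apply, ih, List.reverse_cons, actWord,
      actWord, List.foldl_append]
    obtain ⟨q, _ | _⟩ := s
    · simp only [List.foldl_cons, List.foldl_nil, hfalse]
      simp [presentation, FreeGroup.lift_mk]
      rfl
    · simp only [List.foldl_cons, List.foldl_nil, htrue]
      simp [presentation, FreeGroup.lift_mk]
      rfl

theorem presentation_mk_eq_one_iff (h : T.IsInvertible) (w : List (Q × Bool)) :
    T.presentation h (FreeGroup.mk w) = 1 ↔
      ∀ u, (T.withInverse h).actWord w.reverse u = u := by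
  simp only [← coe_presentation_mk, Subtype.ext_iff, Equiv.ext_iff]
  rfl

theorem presentation_mk_pow_eq_one_iff (h : T.IsInvertible) (y : List (Q × Bool)) (n : ℕ) :
    T.presentation h (FreeGroup.mk y ^ n) = 1 ↔
      ∀ u, (T.withInverse h).actWord (List.replicate n y.reverse).flatten u = u := by
  rw [← FreeGroup.mk_flatten_replicate, presentation_mk_eq_one_iff]
  simp [List.reverse_flatten]

theorem reduce_reverse [DecidableEq Q] {y : List (Q × Bool)} (hy : FreeGroup.reduce y = y) :
    FreeGroup.reduce y.reverse = y.reverse := by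
  have h := FreeGroup.isReduced_iff_reduce_eq.2 hy
  refine FreeGroup.IsReduced.reduce_eq (List.isChain_reverse.2 (h.imp ?_))
  exact fun a b hab heq => (hab heq.symm).symm

theorem exists_finite_cycle_iff_exists_torsion [Finite Q] [DecidableEq Q] [Finite A]
    (hT : T.IsBireversible) :
    (∃ (y : List (Q × Bool)) (hy : y ≠ []),
        FreeGroup.reduce y = y ∧ T.schreierSize hT (Stream'.cycle y hy) < ⊤) ↔
      ¬ Function.Injective (T.presentation hT.isInvertible) ∧
        ∃ (y : List (Q × Bool)) (r : ℕ), 0 < r ∧ FreeGroup.reduce y ≠ [] ∧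
          T.presentation hT.isInvertible (FreeGroup.mk y ^ r) = 1 := by
  have hD1 := T.next_withInverse_injective hT
  have hD2 := T.bijective_out_withInverse hT.isInvertible
  constructor
  · rintro ⟨y, hy, hyr, hfin⟩
    rw [schreierSize_eq, Set.encard_lt_top_iff] at hfin
    obtain ⟨n, hn, hact⟩ := exists_period_of_finite_streamOrbit hD1 hD2 hfin
      (List.length_pos_iff.2 hy) (Stream'.drop_length_cycle y hy)
    have hr : FreeGroup.reduce y.reverse ≠ [] := by
      rw [reduce_reverse hyr]
      simpa using hy
    have hone : T.presentation hT.isInvertible (FreeGroup.mk y.reverse ^ n) = 1 := by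
      rw [presentation_mk_pow_eq_one_iff, List.reverse_reverse, ← Stream'.take_cycle y hy]
      exact hact
    -- Torsion in the image rules out injectivity, since the free group is torsion-free.
    refine ⟨fun hinj => hr ?_, y.reverse, n, hn, hr, hone⟩
    rw [← FreeGroup.toWord_mk, FreeGroup.toWord_eq_nil_iff]
    exact (pow_eq_one_iff_left hn.ne').1 (hinj (hone.trans (map_one _).symm))
  · rintro ⟨-, y, r, hr, hy, hone⟩
    have hy' : (FreeGroup.reduce y).reverse ≠ [] := by simpa using hy
    refine ⟨(FreeGroup.reduce y).reverse, hy', reduce_reverse FreeGroup.reduce.idem, ?_⟩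
    rw [schreierSize_eq, Set.encard_lt_top_iff]
    rw [← FreeGroup.reduce.self, presentation_mk_pow_eq_one_iff, ← Stream'.take_cycle _ hy']
      at hone
    exact finite_streamOrbit_of_period hD1 (Nat.mul_pos (List.length_pos_iff.2 hy') hr)
      (Stream'.drop_mul_period (Stream'.drop_length_cycle _ hy') r) hone

end Transducer

/-! ### Convergence to the boundary and stationarity of bounded sequences -/

theorem commonLength_le {X : Type*} [DecidableEq X] (w : List X) (ξ : Stream' X) :
    commonLength w ξ ≤ w.length :=
  Nat.findGreatest_le _

theorem commonLength_take {X : Type*} [DecidableEq X] (ξ : Stream' X) (n : ℕ) :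
    commonLength (ξ.take n) ξ = n := by
  refine le_antisymm ((commonLength_le _ _).trans_eq (Stream'.length_take _ _)) ?_
  exact Nat.le_findGreatest (Stream'.length_take _ _).ge List.prefix_rfl

theorem boundaryDist_eq {X : Type*} [DecidableEq X] (w : List X) (ξ : Stream' X) :
    boundaryDist w ξ = (1 / 2 : ℝ) ^ commonLength w ξ := by
  rw [boundaryDist, zpow_neg, zpow_natCast, one_div, inv_pow]

theorem IsReducedStream.isEssentiallyNontrivial {Q : Type*} [DecidableEq Q]
    {ξ : Stream' (Q × Bool)} (h : IsReducedStream ξ) : IsEssentiallyNontrivial ξ := by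
  refine ⟨id, strictMono_id, ξ, h, ?_⟩
  have heq : (fun j => boundaryDist (FreeGroup.reduce (ξ.take (id j))) ξ) =
      fun j => (1 / 2 : ℝ) ^ j := by
    funext j
    rw [boundaryDist_eq, id, (h j).reduce_eq, commonLength_take]
  rw [heq]
  exact tendsto_pow_atTop_nhds_zero_of_lt_one (by norm_num) (by norm_num)

/-- A distance below `2⁻ᴺ` to the limit means a common prefix of more than `N` letters, all of them
letters of the reduced prefix of `u`. -/
theorem IsEssentiallyNontrivial.exists_le_length_reduce {Q : Type*} [DecidableEq Q]
    {u : Stream' (Q × Bool)} (h : IsEssentiallyNontrivial u) (N : ℕ) :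
    ∃ n, N ≤ (FreeGroup.reduce (u.take n)).length := by
  obtain ⟨φ, -, ξ, -, hlim⟩ := h
  obtain ⟨j, hj⟩ := (hlim.eventually_lt_const
    (show (0 : ℝ) < (1 / 2) ^ N by positivity)).exists
  rw [boundaryDist_eq, pow_lt_pow_iff_right_of_lt_one₀ (by norm_num) (by norm_num)] at hj
  exact ⟨φ j, hj.le.trans (commonLength_le _ _)⟩

theorem ENat.exists_forall_eq_of_monotone {f : ℕ → ℕ∞} (hf : Monotone f) {s : ℕ∞} (hs : s < ⊤)
    (hfs : ∀ n, f n ≤ s) : ∃ m, 1 ≤ m ∧ ∀ i, f m = f (m + i) := by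
  lift f to ℕ → ℕ using fun n => ((hfs n).trans_lt hs).ne with g
  lift s to ℕ using hs.ne
  have hbdd : BddAbove (Set.range g) := ⟨s, by rintro _ ⟨n, rfl⟩; exact_mod_cast hfs n⟩
  obtain ⟨m, hm⟩ := Nat.sSup_mem (Set.range_nonempty g) hbdd
  have hmax (n : ℕ) : g n ≤ g m := hm ▸ le_csSup hbdd ⟨n, rfl⟩
  -- The maximum may be attained at `0`; the shift ensures a positive index.
  refine ⟨m + 1, by omega, fun i => le_antisymm (hf (Nat.le_add_right _ _)) ?_⟩
  exact (Nat.cast_le.2 (hmax _)).trans (hf (Nat.le_succ m))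

/-! ### The equivalences -/

namespace Transducer

variable {Q A : Type*} [Fintype Q] [Nonempty Q] [DecidableEq Q] [Fintype A] {T : Transducer Q A}

theorem tfae_chi_stationary (hT : T.IsBireversible) {m : ℕ} (hm : 1 ≤ m) : List.TFAE [
    ∃ (x y : List (Q × Bool)) (hy : y ≠ []),
      FreeGroup.reduce (x ++ y) = x ++ y ∧
      x.length + y.length ≤
        m + (2 ^ m * Fintype.card A * Fintype.card Q ^ m) ^ Fintype.card A ∧
      T.schreierSize hT (Stream'.appendStream' x (Stream'.cycle y hy)) =
        T.chi hT.isInvertible m,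
    ∀ i ≤ (2 ^ m * Fintype.card A * Fintype.card Q ^ m) ^ Fintype.card A,
      T.chi hT.isInvertible m = T.chi hT.isInvertible (m + i),
    ∀ i : ℕ, T.chi hT.isInvertible m = T.chi hT.isInvertible (m + i)] := by
  tfae_have 3 → 2 := fun h i _ => h i
  tfae_have 2 → 1 := by
    intro h
    obtain ⟨x, y, hy, hred, hlen, hs⟩ := exists_periodic_of_chi_eq hT hm h
    refine ⟨x, y, hy, ?_, hlen, hs⟩
    -- The prefix of this length is exactly `xy`.
    have := hred (x.length + y.length * 1)
    rw [Stream'.take_append_cycle] at this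
    simpa using this.reduce_eq
  tfae_have 1 → 3 := by
    rintro ⟨x, y, hy, hred, -, hs⟩ i
    exact le_antisymm (chi_mono hT (Nat.le_add_right _ _))
      ((chi_le_schreierSize hT hy hred _).trans_eq hs)
  tfae_finish

end Transducer

theorem mainTheorem2 {Q A : Type*} [Fintype Q] [Nonempty Q] [DecidableEq Q] [Fintype A]
    (T : Transducer Q A) (hT : T.IsBireversible) :
    (List.TFAE [
      -- (i)
      ∃ v : Stream' (Q × Bool), IsEssentiallyNontrivial v ∧ T.schreierSize hT v < ⊤,
      -- (ii)
      ∃ m : ℕ, 1 ≤ m ∧ ∃ (x y : List (Q × Bool)) (hy : y ≠ []),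
        FreeGroup.reduce (x ++ y) = x ++ y ∧
        x.length + y.length ≤
          m + (2 ^ m * Fintype.card A * Fintype.card Q ^ m) ^ Fintype.card A ∧
        T.schreierSize hT (Stream'.appendStream' x (Stream'.cycle y hy)) =
          T.chi hT.isInvertible m,
      -- (iii)
      ∃ m : ℕ, 1 ≤ m ∧
        ∀ i ≤ (2 ^ m * Fintype.card A * Fintype.card Q ^ m) ^ Fintype.card A,
          T.chi hT.isInvertible m = T.chi hT.isInvertible (m + i),
      -- (iv)
      ∃ m : ℕ, 1 ≤ m ∧ ∀ i : ℕ, T.chi hT.isInvertible m = T.chi hT.isInvertible (m + i),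
      -- (v)
      ∃ (y : List (Q × Bool)) (hy : y ≠ []),
        FreeGroup.reduce y = y ∧ T.schreierSize hT (Stream'.cycle y hy) < ⊤,
      -- (vi)
      ¬ Function.Injective (T.presentation hT.isInvertible) ∧
        ∃ (y : List (Q × Bool)) (r : ℕ), 0 < r ∧ FreeGroup.reduce y ≠ [] ∧
          T.presentation hT.isInvertible (FreeGroup.mk y ^ r) = 1]) ∧
    (∀ m : ℕ, 1 ≤ m → List.TFAE [
      -- (ii) for this `m`
      ∃ (x y : List (Q × Bool)) (hy : y ≠ []),
        FreeGroup.reduce (x ++ y) = x ++ y ∧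
        x.length + y.length ≤
          m + (2 ^ m * Fintype.card A * Fintype.card Q ^ m) ^ Fintype.card A ∧
        T.schreierSize hT (Stream'.appendStream' x (Stream'.cycle y hy)) =
          T.chi hT.isInvertible m,
      -- (iii) for this `m`
      ∀ i ≤ (2 ^ m * Fintype.card A * Fintype.card Q ^ m) ^ Fintype.card A,
        T.chi hT.isInvertible m = T.chi hT.isInvertible (m + i),
      -- (iv) for this `m`
      ∀ i : ℕ, T.chi hT.isInvertible m = T.chi hT.isInvertible (m + i)]) := by
  refine ⟨?_, fun m hm => T.tfae_chi_stationary hT hm⟩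
  have hm {m : ℕ} (hm : 1 ≤ m) := T.tfae_chi_stationary hT hm
  have periodic {m : ℕ} (h1 : 1 ≤ m)
      (h : ∀ i : ℕ, T.chi hT.isInvertible m = T.chi hT.isInvertible (m + i)) :=
    Transducer.exists_periodic_of_chi_eq hT h1 fun i _ => h i
  tfae_have 2 ↔ 3 := exists_congr fun m => and_congr_right fun h1 => (hm h1).out 0 1
  tfae_have 3 ↔ 4 := exists_congr fun m => and_congr_right fun h1 => (hm h1).out 1 2
  tfae_have 1 → 4 := by
    rintro ⟨v, hv, hfin⟩
    refine ENat.exists_forall_eq_of_monotone (Transducer.chi_mono hT) hfin fun N => ?_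
    obtain ⟨n, hn⟩ := hv.exists_le_length_reduce N
    exact (Transducer.chi_mono hT hn).trans (Transducer.chi_length_reduce_take_le hT v n)
  tfae_have 4 → 1 := by
    rintro ⟨m, h1, h⟩
    obtain ⟨x, y, hy, hred, -, hs⟩ := periodic h1 h
    exact ⟨_, hred.isEssentiallyNontrivial, hs.trans_lt (Transducer.chi_lt_top hT m)⟩
  tfae_have 4 → 5 := by
    rintro ⟨m, h1, h⟩
    obtain ⟨x, y, hy, hred, -, hs⟩ := periodic h1 h
    refine ⟨y, hy, ?_, ?_⟩
    · have := hred (x.length + y.length * 1)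
      rw [Stream'.take_append_cycle] at this
      simpa using (this.infix (List.suffix_append _ _).isInfix).reduce_eq
    -- Deleting the preperiod `x` does not enlarge the orbit.
    · refine lt_of_le_of_lt ?_ (hs.trans_lt (Transducer.chi_lt_top hT m))
      rw [Transducer.schreierSize_eq, Transducer.schreierSize_eq]
      have := Transducer.encard_streamOrbit_drop_le (T.next_withInverse_injective hT)
        (T.bijective_out_withInverse hT.isInvertible) x.length
        (Stream'.appendStream' x (Stream'.cycle y hy))
      rwa [Stream'.drop_append_stream] at this
  tfae_have 5 → 4 := by
    rintro ⟨y, hy, hyr, hfin⟩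
    exact ENat.exists_forall_eq_of_monotone (Transducer.chi_mono hT) hfin
      fun N => Transducer.chi_le_schreierSize hT (x := []) hy hyr N
  tfae_have 5 ↔ 6 := Transducer.exists_finite_cycle_iff_exists_torsion hT
  tfae_finish
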